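/- Let $n\ge 1$ and let $\sigma\colon\mathbf R^n\to\mathbf R^n$ be continuous with $|\sigma(p)|\le c_1(|p|+1)$ for all $p\in\mathbf R^n$, where $c_1>0$ is a constant. Write $\omega=(s,z)\in\mathbf R\times\mathbf R^n=\mathbf R^{1+n}$, and write real $(1+n)\times(n+1)$ matrices in block form as $$\xi=\begin{pmatrix}p&r\\ B&\beta\end{pmatrix},\qquad p,\beta\in\mathbf R^n,\quad r\in\mathbf R,\quad B\in\mathbf M^{n\times n}.$$ Let $f(\omega,\xi)=|\sigma(p)-\beta|^2+(s-\operatorname{tr}B)^2$. For a cube $Q\subset\mathbf R^{n+1}$ with points $(x,t)$, $x\in\mathbf R^n$, $t\in\mathbf R$, let $$f^\#(\omega,\xi)=\inf_{\zeta\in C_0^\infty(Q;\mathbf R^{1+n})}\frac1{|Q|}\int_Q f\bigl(\omega,\xi+\nabla\zeta(x,t)\bigr)\,dx\,dt,$$ where $\nabla\zeta$ is the $(1+n)\times(n+1)$ matrix of first partial derivatives of $\zeta$ in $(x,t)$, with the $t$-derivatives in the last column. Then, for every cube $Q$ and all $\omega$ and $\xi$, $$f^\#(\omega,\xi)=g(p,\beta)+(s-\operatorname{tr}B)^2,$$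 where $g$ is the convex hull of the function $(p,\beta)\mapsto|\sigma(p)-\beta|^2$ on $\mathbf R^n\times\mathbf R^n$, i.e. the largest convex function on $\mathbf R^n\times\mathbf R^n$ that lies below it. -/

import Mathlib

open MeasureTheory

noncomputable section

namespace DiffusionRelaxation

/-- `ℝⁿ` with its Euclidean norm. -/
abbrev Rn (n : ℕ) : Type := EuclideanSpace ℝ (Fin n)

/-- The domain space `ℝⁿ⁺¹` of the points `(x, t)`: the coordinates `Sum.inl j` are those of `x`
and the coordinate `Sum.inr ()` is `t`. -/
abbrev SpaceTime (n : ℕ) : Type := EuclideanSpace ℝ (Fin n ⊕ Unit)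

/-- The target space `ℝ¹⁺ⁿ` of the vectors `ω = (s, z)`: the coordinate `Sum.inl ()` is `s` and
the coordinates `Sum.inr i` are those of `z`. -/
abbrev Target (n : ℕ) : Type := EuclideanSpace ℝ (Unit ⊕ Fin n)

/-- The `(1+n) × (n+1)` real matrices, in the block form `ξ = (p, r; B, β)`. -/
abbrev GradMatrix (n : ℕ) : Type := Matrix (Unit ⊕ Fin n) (Fin n ⊕ Unit) ℝ

variable {n : ℕ}

/-- The upper left block `p` of `ξ = (p, r; B, β)`, as a vector. -/
def pBlock (ξ : GradMatrix n) : Rn n := WithLp.toLp 2 fun j => ξ (Sum.inl ()) (Sum.inl j)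

/-- The lower left block `B` of `ξ = (p, r; B, β)`. -/
def BBlock (ξ : GradMatrix n) : Matrix (Fin n) (Fin n) ℝ := ξ.toBlocks₂₁

/-- The lower right block `β` of `ξ = (p, r; B, β)`, as a vector. -/
def betaBlock (ξ : GradMatrix n) : Rn n := WithLp.toLp 2 fun i => ξ (Sum.inr i) (Sum.inr ())

/-- The gradient matrix `∇w(y)`, with entries `∂wᵢ/∂yⱼ(y)`. -/
def gradMatrix (w : SpaceTime n → Target n) (y : SpaceTime n) : GradMatrix n :=
  Matrix.of fun i j => (fderiv ℝ w y (EuclideanSpace.single j 1)) i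

/-- The density `f(ω, ξ) = |σ(p) - β|² + (s - tr B)²`. -/
def density (σ : Rn n → Rn n) (ω : Target n) (ξ : GradMatrix n) : ℝ :=
  ‖σ (pBlock ξ) - betaBlock ξ‖ ^ 2 + (ω (Sum.inl ()) - (BBlock ξ).trace) ^ 2

/-- `Q` is an open cube in `ℝⁿ⁺¹`, with vertex `a`, side length `L > 0` and edges along some
orthonormal basis `b` (for the standard basis, a cube with faces parallel to the axes). -/
def IsOpenCube (Q : Set (SpaceTime n)) : Prop :=
  ∃ (b : OrthonormalBasis (Fin n ⊕ Unit) ℝ (SpaceTime n)) (a : SpaceTime n) (L : ℝ),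
    0 < L ∧ Q = {y | ∀ i, inner ℝ (b i) (y - a) ∈ Set.Ioo 0 L}

/-- The test functions `C₀^∞(Q; ℝ¹⁺ⁿ)`. -/
def testFunctions (Q : Set (SpaceTime n)) : Set (SpaceTime n → Target n) :=
  {ζ | ContDiff ℝ ((⊤ : ℕ∞) : WithTop ℕ∞) ζ ∧ HasCompactSupport ζ ∧ tsupport ζ ⊆ Q}

/-- `F^#(ω, ξ) = inf_ζ |Q|⁻¹ ∫_Q F(ω, ξ + ∇ζ(x, t)) dx dt` over `ζ ∈ C₀^∞(Q; ℝ¹⁺ⁿ)`. -/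
def sharp (Q : Set (SpaceTime n)) (F : Target n → GradMatrix n → ℝ)
    (ω : Target n) (ξ : GradMatrix n) : ℝ :=
  sInf ((fun ζ : SpaceTime n → Target n =>
    (volume.real Q)⁻¹ * ∫ y in Q, F ω (ξ + gradMatrix ζ y)) '' testFunctions Q)

/-- The convex hull of a function `F : E → ℝ`: the pointwise supremum of all convex functions
`h ≤ F` on `E`. (For `F ≥ 0`, as below, the set of such `h` contains `0` and their values at `x`
are bounded above by `F x`, so that the supremum is a genuine one.) -/
def convexHullFun {E : Type*} [AddCommGroup E] [Module ℝ E] (F : E → ℝ) (x : E) : ℝ :=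
  sSup {v : ℝ | ∃ h : E → ℝ, ConvexOn ℝ Set.univ h ∧ (∀ y, h y ≤ F y) ∧ v = h x}

/-- `g(p, β)`: the convex hull of `(p, β) ↦ |σ(p) - β|²` on `ℝⁿ × ℝⁿ`. -/
def gHull (σ : Rn n → Rn n) (p β : Rn n) : ℝ :=
  convexHullFun (fun x : Rn n × Rn n => ‖σ x.1 - x.2‖ ^ 2) (p, β)

end DiffusionRelaxation

end

/-! The density sees a gradient only through `(p, β)` and `tr B`, collected linearly in `readout`;
the block `r` is free.

Lower bound (`convex_le_average`): for convex `h` below `F(p, β) = |σ(p) - β|²`, the map `((p, β),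
τ) ↦ h(p, β) + (s - τ)²` is convex, and gradients of test functions have mean zero. Jensen's
inequality applies, and then one takes the supremum over `h`.

Upper bound: any direction `(a, b)` is realised by rank-one matrices whose trace tends to zero. The
phase gradient `(a/ε, 1/ε²)` with amplitude `(ε, ε² b)` gives `p = a`, `β = b`, `B = ε b ⊗ a` and `r
= 1/ε` (`readout_phase`). Since the amplitude also tends to zero, cutting off costs little, and
`exists_laminate` oscillates between two arbitrary states of `(p, β)` with small spatial divergence.
`Relaxes` quantifies over all bounded open sets, so further test functions can be inserted directly
into the open layers of a laminate. Hence relaxed values are stable under convex combinations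
(`Relaxes.convexComb`), their infimum `relaxation F` is a convex function below `F`, and so it lies
below the convex hull. The divergence term changes by an arbitrarily small amount
(`exists_average_le`). -/

noncomputable section

namespace DiffusionRelaxation

/-! ### Smoothed periodic step functions and their primitives -/

/-- A smooth step: it vanishes off `(0, l + η)` and equals `1` on `[η, l]`. -/
def plateau (l η x : ℝ) : ℝ :=
  Real.smoothTransition (x / η) - Real.smoothTransition ((x - l) / η)

lemma plateau_of_nonpos {l η x : ℝ} (hη : 0 < η) (hl : 0 ≤ l) (hx : x ≤ 0) :
    plateau l η x = 0 := by
  unfold plateau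
  rw [Real.smoothTransition.zero_of_nonpos (div_nonpos_of_nonpos_of_nonneg hx hη.le),
    Real.smoothTransition.zero_of_nonpos
      (div_nonpos_of_nonpos_of_nonneg (by linarith) hη.le), sub_zero]

lemma plateau_of_add_le {l η x : ℝ} (hη : 0 < η) (hl : 0 ≤ l) (hx : l + η ≤ x) :
    plateau l η x = 0 := by
  unfold plateau
  rw [Real.smoothTransition.one_of_one_le ((one_le_div hη).2 (by linarith)),
    Real.smoothTransition.one_of_one_le ((one_le_div hη).2 (by linarith)), sub_self]

lemma plateau_eq_one {l η x : ℝ} (hη : 0 < η) (h1 : η ≤ x) (h2 : x ≤ l) :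
    plateau l η x = 1 := by
  unfold plateau
  rw [Real.smoothTransition.one_of_one_le ((one_le_div hη).2 h1),
    Real.smoothTransition.zero_of_nonpos
      (div_nonpos_of_nonpos_of_nonneg (by linarith) hη.le), sub_zero]

lemma plateau_mem_Icc {l η : ℝ} (hη : 0 < η) (hl : 0 ≤ l) (x : ℝ) :
    plateau l η x ∈ Set.Icc 0 1 := by
  have h1 : Real.smoothTransition ((x - l) / η) ≤ Real.smoothTransition (x / η) :=
    Real.smoothTransition.monotone (by gcongr; linarith)
  have h2 := Real.smoothTransition.le_one (x / η)
  have h3 := Real.smoothTransition.nonneg ((x - l) / η)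
  unfold plateau
  constructor <;> linarith

lemma contDiff_plateau (l η : ℝ) : ContDiff ℝ ((⊤ : ℕ∞) : WithTop ℕ∞) (plateau l η) := by
  unfold plateau
  exact (Real.smoothTransition.contDiff.comp (contDiff_id.div_const η)).sub
    (Real.smoothTransition.contDiff.comp ((contDiff_id.sub contDiff_const).div_const η))

/-- Two translates of one step cancel except on end intervals of length `l`, where the step is `1`
and `0`. The value does not depend on `η`, so subtracting `l` gives mean zero exactly. -/
lemma integral_plateau {l η : ℝ} (hη : 0 < η) (hl : 0 ≤ l) (hlη : l + η ≤ 1) :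
    ∫ x in (0 : ℝ)..1, plateau l η x = l := by
  have hc : Continuous fun x : ℝ => Real.smoothTransition (x / η) :=
    Real.smoothTransition.continuous.comp (continuous_id.div_const η)
  have hi : ∀ a b : ℝ, IntervalIntegrable (fun x : ℝ => Real.smoothTransition (x / η)) volume a b :=
    fun a b => hc.intervalIntegrable a b
  unfold plateau
  rw [intervalIntegral.integral_sub (hi 0 1)
    ((show Continuous fun x : ℝ => Real.smoothTransition ((x - l) / η) from
      hc.comp (continuous_id.sub continuous_const)).intervalIntegrable 0 1),
    intervalIntegral.integral_comp_sub_right (fun x => Real.smoothTransition (x / η)) l,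
    ← intervalIntegral.integral_add_adjacent_intervals (hi 0 (1 - l)) (hi (1 - l) 1),
    ← intervalIntegral.integral_add_adjacent_intervals (hi (0 - l) 0) (hi 0 (1 - l))]
  have h1 : ∫ x in (1 - l)..1, Real.smoothTransition (x / η) = ∫ x in (1 - l)..1, (1 : ℝ) := by
    refine intervalIntegral.integral_congr fun x hx => ?_
    rw [Set.uIcc_of_le (by linarith)] at hx
    exact Real.smoothTransition.one_of_one_le ((one_le_div hη).2 (by linarith [hx.1]))
  have h2 : ∫ x in (0 - l)..0, Real.smoothTransition (x / η) = ∫ x in (0 - l)..0, (0 : ℝ) := by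
    refine intervalIntegral.integral_congr fun x hx => ?_
    rw [Set.uIcc_of_le (by linarith)] at hx
    exact Real.smoothTransition.zero_of_nonpos (div_nonpos_of_nonpos_of_nonneg hx.2 hη.le)
  rw [h1, h2]
  simp

/-- The gap `[l + η, 1]`, where the profile vanishes, lets a single translate describe the periodic
function on both sides of an integer; smoothness there follows. -/
lemma plateau_fract_eq {l η : ℝ} (hη : 0 < η) (hl : 0 ≤ l) {k : ℤ} {x : ℝ}
    (h1 : (k : ℝ) - (1 - l - η) < x) (h2 : x < k + 1) :
    plateau l η (Int.fract x) = plateau l η (x - k) := by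
  rcases le_or_gt (k : ℝ) x with h | h
  · have : ⌊x⌋ = k := Int.floor_eq_iff.2 ⟨h, h2⟩
    rw [Int.fract, this]
  · have : ⌊x⌋ = k - 1 := Int.floor_eq_iff.2 ⟨by push_cast; linarith, by push_cast; linarith⟩
    rw [Int.fract, this, plateau_of_nonpos hη hl (by linarith : x - k ≤ 0),
      plateau_of_add_le hη hl (by push_cast; linarith)]

lemma contDiff_plateau_fract {l η : ℝ} (hη : 0 < η) (hl : 0 ≤ l) (hlη : l + η < 1) :
    ContDiff ℝ ((⊤ : ℕ∞) : WithTop ℕ∞) (fun x => plateau l η (Int.fract x)) := by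
  rw [contDiff_iff_contDiffAt]
  intro x
  have hev : (fun x => plateau l η (Int.fract x)) =ᶠ[nhds x]
      fun y => plateau l η (y - (⌊x⌋ : ℤ)) := by
    filter_upwards [Ioo_mem_nhds (a := (⌊x⌋ : ℝ) - (1 - l - η)) (b := ⌊x⌋ + 1)
      (by linarith [Int.floor_le x]) (Int.lt_floor_add_one x)] with y hy
    exact plateau_fract_eq hη hl hy.1 hy.2
  exact ContDiffAt.congr_of_eventuallyEq (f := fun y => plateau l η (y - (⌊x⌋ : ℤ)))
    ((contDiff_plateau l η).comp
    (contDiff_id.sub contDiff_const)).contDiffAt hev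

/-- A bounded smooth primitive of a smoothed periodic two-valued step function of mean zero. -/
lemma exists_profile {l η : ℝ} (hη : 0 < η) (hl : 0 ≤ l) (hlη : l + η < 1) :
    ∃ w : ℝ → ℝ, ContDiff ℝ ((⊤ : ℕ∞) : WithTop ℕ∞) w ∧
      (∀ x, HasDerivAt w (plateau l η (Int.fract x) - l) x) ∧ ∃ C, ∀ x, |w x| ≤ C := by
  have hs := contDiff_plateau_fract hη hl hlη
  set q : ℝ → ℝ := fun x => plateau l η (Int.fract x) - l with hq
  have hqs : ContDiff ℝ ((⊤ : ℕ∞) : WithTop ℕ∞) q := hs.sub contDiff_const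
  have hqc : Continuous q := hqs.continuous
  have hqp : Function.Periodic q 1 := fun x => by simp [hq]
  have hd : ∀ x, HasDerivAt (fun x => ∫ t in (0 : ℝ)..x, q t) (q x) x := fun x =>
    intervalIntegral.integral_hasDerivAt_right (hqc.intervalIntegrable _ _)
      (hqc.stronglyMeasurableAtFilter _ _) hqc.continuousAt
  have h01 : ∫ t in (0 : ℝ)..1, q t = 0 := by
    have : ∫ t in (0 : ℝ)..1, q t = ∫ t in (0 : ℝ)..1, (plateau l η t - l) := by
      refine intervalIntegral.integral_congr_ae ?_
      have : ∀ᵐ t : ℝ, t ≠ 1 := by simp [ae_iff]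
      filter_upwards [this] with t ht hmem
      rw [Set.uIoc_of_le zero_le_one] at hmem
      simp only [hq]
      rw [Int.fract_eq_self.2 ⟨hmem.1.le, lt_of_le_of_ne hmem.2 ht⟩]
    rw [this, intervalIntegral.integral_sub
      ((contDiff_plateau l η).continuous.intervalIntegrable _ _) (by simp), integral_plateau hη hl hlη.le]
    simp
  -- Mean zero over a period makes the primitive periodic, hence bounded.
  have hper : Function.Periodic (fun x => ∫ t in (0 : ℝ)..x, q t) 1 := fun x => by
    simp only
    rw [hqp.intervalIntegral_add_eq_add 0 x (fun a b => hqc.intervalIntegrable a b)]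
    simp [h01]
  refine ⟨fun x => ∫ t in (0 : ℝ)..x, q t, ?_, hd, ?_⟩
  · rw [contDiff_infty_iff_deriv]
    refine ⟨fun x => (hd x).differentiableAt, ?_⟩
    have : deriv (fun x => ∫ t in (0 : ℝ)..x, q t) = q := funext fun x => (hd x).deriv
    rw [this]
    exact hqs
  · have hb := hper.isBounded_of_continuous one_ne_zero
      (continuous_iff_continuousAt.2 fun x => (hd x).continuousAt)
    obtain ⟨C, hC⟩ := hb.exists_norm_le
    exact ⟨C, fun x => hC _ ⟨x, rfl⟩⟩

/-! ### Phase selection by averaging, and cutoffs -/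

/-- Some shift of the phase does at least as well as the average over all shifts. -/
lemma exists_phase_shift {X : Type*} [MeasurableSpace X] (μ : Measure X) [IsFiniteMeasure μ]
    {θ : X → ℝ} (hθ : Measurable θ) {c : ℝ → ℝ} (hc : Measurable c) {C : ℝ}
    (hC : ∀ x, |c x| ≤ C) :
    ∃ s : ℝ, ∫ y, c (Int.fract (θ y + s)) ∂μ ≤ μ.real Set.univ * ∫ t in (0 : ℝ)..1, c t := by
  have hm : Measurable fun z : ℝ × X => c (Int.fract (θ z.2 + z.1)) :=
    hc.comp (measurable_fract.comp ((hθ.comp measurable_snd).add measurable_fst))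
  have hi : Integrable (fun z : ℝ × X => c (Int.fract (θ z.2 + z.1)))
      ((volume.restrict (Set.Ioc (0 : ℝ) 1)).prod μ) :=
    Integrable.of_bound hm.aestronglyMeasurable C (Filter.Eventually.of_forall fun z => hC _)
  have : IsProbabilityMeasure (volume.restrict (Set.Ioc (0 : ℝ) 1)) := ⟨by simp⟩
  obtain ⟨s, hs⟩ := exists_le_integral hi.integral_prod_left
  refine ⟨s, hs.trans_eq ?_⟩
  -- By Fubini, each `y` contributes a full period of `c`, whatever the value `θ y`; no
  -- equidistribution of `θ` is needed.
  rw [integral_integral_swap hi]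
  have hper : Function.Periodic (fun x => c (Int.fract x)) 1 := fun x => by simp
  have hin : ∀ y, ∫ t in Set.Ioc (0 : ℝ) 1, c (Int.fract (θ y + t)) = ∫ t in (0 : ℝ)..1, c t := by
    intro y
    rw [← intervalIntegral.integral_of_le zero_le_one,
      intervalIntegral.integral_comp_add_left (fun x => c (Int.fract x)) (θ y), add_zero,
      hper.intervalIntegral_add_eq (θ y) 0, zero_add]
    refine intervalIntegral.integral_congr_ae ?_
    have : ∀ᵐ t : ℝ, t ≠ 1 := by simp [ae_iff]
    filter_upwards [this] with t ht hmem
    rw [Set.uIoc_of_le zero_le_one] at hmem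
    rw [Int.fract_eq_self.2 ⟨hmem.1.le, lt_of_le_of_ne hmem.2 ht⟩]
  simp [hin]

lemma isOpen_fract_mem_Ioo {a b : ℝ} (ha : 0 ≤ a) (hb : b ≤ 1) :
    IsOpen {x : ℝ | Int.fract x ∈ Set.Ioo a b} := by
  have : {x : ℝ | Int.fract x ∈ Set.Ioo a b} = ⋃ k : ℤ, Set.Ioo (k + a) (k + b) := by
    ext x
    simp only [Set.mem_ofPred_eq, Set.mem_iUnion, Set.mem_Ioo]
    constructor
    · rintro ⟨h1, h2⟩
      refine ⟨⌊x⌋, ?_, ?_⟩ <;> linarith [Int.floor_add_fract x]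
    · rintro ⟨k, h1, h2⟩
      have : ⌊x⌋ = k := Int.floor_eq_iff.2 ⟨by linarith, by linarith⟩
      rw [Int.fract, this]
      constructor <;> linarith
  rw [this]
  exact isOpen_iUnion fun k => isOpen_Ioo

lemma exists_cutoff {E : Type*} [NormedAddCommGroup E] [NormedSpace ℝ E] [FiniteDimensional ℝ E]
    {K O : Set E} (hK : IsCompact K) (hO : IsOpen O) (hKO : K ⊆ O) :
    ∃ χ : E → ℝ, ContDiff ℝ ((⊤ : ℕ∞) : WithTop ℕ∞) χ ∧ HasCompactSupport χ ∧ tsupport χ ⊆ O ∧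
      (∀ y, χ y ∈ Set.Icc 0 1) ∧ ∃ V, IsOpen V ∧ K ⊆ V ∧ V ⊆ O ∧ ∀ y ∈ V, χ y = 1 := by
  obtain ⟨T, hT, hKT, hTO⟩ := exists_compact_between hK hO hKO
  obtain ⟨f, h1, h0, hf⟩ := exists_contMDiffMap_one_nhds_of_subset_interior (n := (⊤ : ℕ∞))
    (modelWithCornersSelf ℝ E) hK.isClosed hKT
  have hsub : tsupport f ⊆ T := closure_minimal
    (fun y hy => by by_contra h; exact hy (h0 y h)) hT.isClosed
  obtain ⟨V, hV, hKV, hV1⟩ := mem_nhdsSet_iff_exists.1 h1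
  refine ⟨f, f.contMDiff.contDiff, hT.of_isClosed_subset (isClosed_tsupport _) hsub,
    hsub.trans hTO, hf, V ∩ O, hV.inter hO, Set.subset_inter hKV hKO, Set.inter_subset_right,
    fun y hy => hV1 hy.1⟩

/-! ### Test functions and the visible part of their gradients -/

variable {n : ℕ}

/-- The part of a gradient `(p, r; B, β)` seen by the density: `((p, β), tr B)`. -/
def readout (n : ℕ) : (SpaceTime n →L[ℝ] Target n) →L[ℝ] (Rn n × Rn n) × ℝ :=
  LinearMap.toContinuousLinearMap
    { toFun := fun D =>
        ((WithLp.toLp 2 fun j => D (EuclideanSpace.single (Sum.inl j) 1) (Sum.inl ()),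
          WithLp.toLp 2 fun i => D (EuclideanSpace.single (Sum.inr ()) 1) (Sum.inr i)),
          ∑ i, D (EuclideanSpace.single (Sum.inl i) 1) (Sum.inr i))
      map_add' := fun D E => by
        ext <;> simp [Finset.sum_add_distrib]
      map_smul' := fun c D => by
        ext <;> simp [Finset.mul_sum] }

lemma readout_apply (D : SpaceTime n →L[ℝ] Target n) :
    readout n D =
      ((WithLp.toLp 2 fun j => D (EuclideanSpace.single (Sum.inl j) 1) (Sum.inl ()),
        WithLp.toLp 2 fun i => D (EuclideanSpace.single (Sum.inr ()) 1) (Sum.inr i)),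
        ∑ i, D (EuclideanSpace.single (Sum.inl i) 1) (Sum.inr i)) := rfl

/-- The pair `(∇ₓu, ∂ₜz)` for `ζ = (u, z)`. -/
def slope (ζ : SpaceTime n → Target n) (y : SpaceTime n) : Rn n × Rn n :=
  (readout n (fderiv ℝ ζ y)).1

/-- The spatial divergence of `z` for `ζ = (u, z)`. -/
def spatialDiv (ζ : SpaceTime n → Target n) (y : SpaceTime n) : ℝ :=
  (readout n (fderiv ℝ ζ y)).2

lemma density_add_gradMatrix (σ : Rn n → Rn n) (ω : Target n) (ξ : GradMatrix n)
    (ζ : SpaceTime n → Target n) (y : SpaceTime n) :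
    density σ ω (ξ + gradMatrix ζ y) =
      (fun x : Rn n × Rn n => ‖σ x.1 - x.2‖ ^ 2) ((pBlock ξ, betaBlock ξ) + slope ζ y) +
        (ω (Sum.inl ()) - ((BBlock ξ).trace + spatialDiv ζ y)) ^ 2 := by
  have hp : pBlock (ξ + gradMatrix ζ y) = pBlock ξ + (slope ζ y).1 := by
    ext j; simp [pBlock, slope, readout_apply, gradMatrix]
  have hβ : betaBlock (ξ + gradMatrix ζ y) = betaBlock ξ + (slope ζ y).2 := by
    ext j; simp [betaBlock, slope, readout_apply, gradMatrix]
  have hB : (BBlock (ξ + gradMatrix ζ y)).trace = (BBlock ξ).trace + spatialDiv ζ y := by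
    simp [BBlock, spatialDiv, readout_apply, gradMatrix, Matrix.trace, Finset.sum_add_distrib,
      Matrix.toBlocks₂₁]
  simp only [density, hp, hβ, hB, Prod.fst_add, Prod.snd_add]

lemma slope_eq_zero_of_notMem {ζ : SpaceTime n → Target n} {y : SpaceTime n}
    (hy : y ∉ tsupport ζ) : slope ζ y = 0 := by
  simp [slope, fderiv_of_notMem_tsupport ℝ hy]

lemma testFunctions_differentiable {Q : Set (SpaceTime n)} {ζ : SpaceTime n → Target n}
    (h : ζ ∈ testFunctions Q) : Differentiable ℝ ζ :=
  h.1.differentiable (by simp)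

lemma zero_mem_testFunctions (Q : Set (SpaceTime n)) :
    (0 : SpaceTime n → Target n) ∈ testFunctions Q :=
  ⟨contDiff_const, HasCompactSupport.zero, by simp [tsupport]⟩

lemma add_mem_testFunctions {Q : Set (SpaceTime n)} {ζ ζ' : SpaceTime n → Target n}
    (h : ζ ∈ testFunctions Q) (h' : ζ' ∈ testFunctions Q) : ζ + ζ' ∈ testFunctions Q :=
  ⟨h.1.add h'.1, h.2.1.add h'.2.1, (tsupport_add ζ ζ').trans (Set.union_subset h.2.2 h'.2.2)⟩

lemma testFunctions_mono {Q Q' : Set (SpaceTime n)} (hQ : Q ⊆ Q') :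
    (testFunctions Q) ⊆ testFunctions Q' :=
  fun _ h => ⟨h.1, h.2.1, h.2.2.trans hQ⟩

lemma fderiv_add_of_mem_testFunctions {Q Q' : Set (SpaceTime n)} {ζ ζ' : SpaceTime n → Target n}
    (h : ζ ∈ testFunctions Q) (h' : ζ' ∈ testFunctions Q') (y : SpaceTime n) :
    fderiv ℝ (ζ + ζ') y = fderiv ℝ ζ y + fderiv ℝ ζ' y :=
  fderiv_add (testFunctions_differentiable h y) (testFunctions_differentiable h' y)

lemma slope_add {Q Q' : Set (SpaceTime n)} {ζ ζ' : SpaceTime n → Target n}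
    (h : ζ ∈ testFunctions Q) (h' : ζ' ∈ testFunctions Q') (y : SpaceTime n) :
    slope (ζ + ζ') y = slope ζ y + slope ζ' y := by
  simp [slope, fderiv_add_of_mem_testFunctions h h']

lemma spatialDiv_add {Q Q' : Set (SpaceTime n)} {ζ ζ' : SpaceTime n → Target n}
    (h : ζ ∈ testFunctions Q) (h' : ζ' ∈ testFunctions Q') (y : SpaceTime n) :
    spatialDiv (ζ + ζ') y = spatialDiv ζ y + spatialDiv ζ' y := by
  simp [spatialDiv, fderiv_add_of_mem_testFunctions h h']

lemma continuous_readout_fderiv {Q : Set (SpaceTime n)} {ζ : SpaceTime n → Target n}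
    (h : ζ ∈ testFunctions Q) : Continuous fun y => readout n (fderiv ℝ ζ y) :=
  (readout n).continuous.comp (h.1.continuous_fderiv (by simp))

lemma continuous_slope {Q : Set (SpaceTime n)} {ζ : SpaceTime n → Target n}
    (h : ζ ∈ testFunctions Q) : Continuous (slope ζ) :=
  continuous_fst.comp (continuous_readout_fderiv h)

lemma continuous_spatialDiv {Q : Set (SpaceTime n)} {ζ : SpaceTime n → Target n}
    (h : ζ ∈ testFunctions Q) : Continuous (spatialDiv ζ) :=
  continuous_snd.comp (continuous_readout_fderiv h)

/-! ### Laminates with small spatial divergence -/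

/-- The phase gradient `(a / ε, 1 / ε²)`. -/
def phaseDir (a : Rn n) (ε : ℝ) : SpaceTime n :=
  WithLp.toLp 2 (Sum.elim (fun j => ε⁻¹ * a j) fun _ => (ε ^ 2)⁻¹)

/-- The amplitude `(ε, ε² b)`. -/
def amplitude (b : Rn n) (ε : ℝ) : Target n :=
  WithLp.toLp 2 (Sum.elim (fun _ => ε) fun i => ε ^ 2 * b i)

/-- The parabolic scaling keeps `p` and `β` fixed while the trace is of order `ε`; the blow-up goes
into `r`, which is not read. -/
lemma readout_phase (a b : Rn n) {ε : ℝ} (hε : ε ≠ 0) :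
    readout n ((innerSL ℝ (phaseDir a ε)).smulRight (amplitude b ε)) =
      ((a, b), ε * ∑ i, a i * b i) := by
  rw [readout_apply]
  refine Prod.ext (Prod.ext ?_ ?_) ?_
  · ext j
    simp [phaseDir, amplitude, EuclideanSpace.inner_single_right]
    field_simp
  · ext j
    simp [phaseDir, amplitude, EuclideanSpace.inner_single_right]
    field_simp
  · simp only [ContinuousLinearMap.smulRight_apply, innerSL_apply_apply, Finset.mul_sum]
    refine Finset.sum_congr rfl fun i _ => ?_
    simp [phaseDir, amplitude, EuclideanSpace.inner_single_right]
    field_simp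

lemma tendsto_amplitude (b : Rn n) :
    Filter.Tendsto (amplitude b) (nhds 0) (nhds 0) := by
  have hc : Continuous (amplitude b) := by
    refine (PiLp.continuous_toLp 2 _).comp (continuous_pi fun i => ?_)
    rcases i with i | i
    · exact continuous_id
    · exact (continuous_id.pow 2).mul continuous_const
  have h0 : amplitude b 0 = 0 := by
    ext i
    rcases i with i | i <;> simp [amplitude]
  simpa [h0] using hc.tendsto 0

/-- A fine oscillation in `O` whose slope runs along the segment spanned by `(a, b)`; it is exact
near `K`. -/
lemma exists_laminate (a b : Rn n) {l η : ℝ} (hη : 0 < η) (hl : 0 ≤ l) (hlη : l + η < 1)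
    {K O : Set (SpaceTime n)} (hK : IsCompact K) (hO : IsOpen O) (hKO : K ⊆ O)
    {δ : ℝ} (hδ : 0 < δ) :
    ∃ V : Set (SpaceTime n), IsOpen V ∧ K ⊆ V ∧ V ⊆ O ∧ ∃ θ : SpaceTime n → ℝ, Continuous θ ∧
      ∀ s : ℝ, ∃ ζ ∈ testFunctions O, (∀ y, |spatialDiv ζ y| ≤ δ) ∧
        (∀ y, ‖slope ζ y‖ ≤ ‖(a, b)‖ + δ) ∧
        ∀ y ∈ V, slope ζ y = (plateau l η (Int.fract (θ y + s)) - l) • (a, b) := by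
  obtain ⟨w, hw, hwd, C, hC⟩ := exists_profile hη hl hlη
  obtain ⟨χ, hχ, hχc, hχO, hχ01, V, hV, hKV, hVO, hχV⟩ := exists_cutoff hK hO hKO
  have hχd : Differentiable ℝ χ := hχ.differentiable (by simp)
  obtain ⟨M, hM⟩ := (hχc.fderiv (𝕜 := ℝ)).exists_bound_of_continuous
    (hχ.continuous_fderiv (by simp))
  have hM0 : 0 ≤ M := (norm_nonneg _).trans (hM 0)
  have hC0 : 0 ≤ C := (abs_nonneg _).trans (hC 0)
  -- the cutoff error and the divergence are small for small `ε`
  obtain ⟨ε, hε, hε1, hε2⟩ : ∃ ε : ℝ, 0 < ε ∧ ‖readout n‖ * (C * M * ‖amplitude b ε‖) < δ / 2 ∧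
      |ε * ∑ i, a i * b i| < δ / 2 := by
    have h1 : Filter.Tendsto (fun ε => ‖readout n‖ * (C * M * ‖amplitude b ε‖)) (nhds 0)
        (nhds 0) := by
      simpa using ((tendsto_amplitude b).norm.const_mul (C * M)).const_mul ‖readout n‖
    have h2 : Filter.Tendsto (fun ε : ℝ => |ε * ∑ i, a i * b i|) (nhds 0) (nhds 0) := by
      simpa using ((Filter.tendsto_id (x := nhds (0 : ℝ))).mul_const (∑ i, a i * b i)).abs
    have h3 := ((h1.eventually (gt_mem_nhds (half_pos hδ))).and
      (h2.eventually (gt_mem_nhds (half_pos hδ)))).filter_mono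
      (nhdsWithin_le_nhds (s := Set.Ioi (0 : ℝ)))
    obtain ⟨ε, h, hpos⟩ := (h3.and self_mem_nhdsWithin).exists
    exact ⟨ε, hpos, h.1, h.2⟩
  refine ⟨V, hV, hKV, hVO, fun y => innerSL ℝ (phaseDir a ε) y,
    (innerSL ℝ (phaseDir a ε)).continuous, fun s => ?_⟩
  set ℓ := innerSL ℝ (phaseDir a ε) with hℓ
  set e := amplitude b ε with he
  have hder : ∀ y, HasFDerivAt (fun y => (χ y * w (ℓ y + s)) • e)
      (((χ y * (plateau l η (Int.fract (ℓ y + s)) - l)) • ℓ +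
        w (ℓ y + s) • fderiv ℝ χ y).smulRight e) y := by
    intro y
    have h1 : HasFDerivAt (fun y => w (ℓ y + s))
        ((plateau l η (Int.fract (ℓ y + s)) - l) • ℓ) y :=
      (hwd (ℓ y + s)).comp_hasFDerivAt y (ℓ.hasFDerivAt.add_const s)
    have h2 := ((hχd y).hasFDerivAt.mul h1).smul_const e
    rw [smul_smul] at h2
    exact h2
  have hread : ∀ y, readout n (fderiv ℝ (fun y => (χ y * w (ℓ y + s)) • e) y) =
      (χ y * (plateau l η (Int.fract (ℓ y + s)) - l)) • ((a, b), ε * ∑ i, a i * b i) +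
        readout n ((w (ℓ y + s) • fderiv ℝ χ y).smulRight e) := by
    intro y
    rw [(hder y).fderiv, ← readout_phase a b hε.ne', ← (readout n).map_smul,
      ← (readout n).map_add]
    congr 1
    ext1 v
    simp only [ContinuousLinearMap.smulRight_apply, _root_.add_apply,
      _root_.smul_apply, smul_eq_mul, add_smul, mul_smul, hℓ, he]
  -- The cutoff error carries the undifferentiated `w`, so it is bounded by `C * M` times the small
  -- amplitude.
  have herr : ∀ y, ‖readout n ((w (ℓ y + s) • fderiv ℝ χ y).smulRight e)‖ ≤ δ / 2 := by
    intro y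
    refine ((readout n).le_opNorm _).trans (le_trans ?_ hε1.le)
    rw [ContinuousLinearMap.norm_smulRight_apply, norm_smul]
    gcongr
    · exact hC _
    · exact hM y
  have hcoef : ∀ y, |χ y * (plateau l η (Int.fract (ℓ y + s)) - l)| ≤ 1 := by
    intro y
    have h1 := plateau_mem_Icc hη hl (Int.fract (ℓ y + s))
    rw [abs_mul]
    refine mul_le_one₀ ?_ (abs_nonneg _) ?_
    · rw [abs_of_nonneg (hχ01 y).1]; exact (hχ01 y).2
    · rw [abs_le]; constructor <;> linarith [h1.1, h1.2]
  have hsupp : tsupport (fun y => (χ y * w (ℓ y + s)) • e) ⊆ tsupport χ := by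
    refine closure_mono fun y hy => ?_
    simp only [Function.mem_support] at hy ⊢
    intro h
    simp [h] at hy
  refine ⟨fun y => (χ y * w (ℓ y + s)) • e, ⟨?_, ?_, hsupp.trans hχO⟩, ?_, ?_, ?_⟩
  · exact (hχ.mul (hw.comp (ℓ.contDiff.add contDiff_const))).smul contDiff_const
  · exact hχc.of_isClosed_subset (isClosed_tsupport _) hsupp
  · intro y
    rw [spatialDiv, hread]
    have h1 := (norm_snd_le _).trans (herr y)
    rw [Real.norm_eq_abs] at h1
    have h2 : |(χ y * (plateau l η (Int.fract (ℓ y + s)) - l)) * (ε * ∑ i, a i * b i)| ≤ δ / 2 := by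
      rw [abs_mul]
      calc _ ≤ 1 * |ε * ∑ i, a i * b i| := by gcongr; exact hcoef y
        _ ≤ δ / 2 := by rw [one_mul]; exact hε2.le
    calc _ ≤ _ := abs_add_le _ _
      _ ≤ δ / 2 + δ / 2 := add_le_add h2 h1
      _ = δ := by ring
  · intro y
    rw [slope, hread]
    have h1 := (norm_fst_le _).trans (herr y)
    calc _ ≤ _ := norm_add_le _ _
      _ ≤ ‖(a, b)‖ + δ / 2 := by
        refine add_le_add ?_ h1
        rw [Prod.smul_fst, norm_smul]
        exact mul_le_of_le_one_left (norm_nonneg _) (hcoef y)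
      _ ≤ ‖(a, b)‖ + δ := by linarith
  · intro y hy
    have h0 : fderiv ℝ χ y = 0 := by
      have : χ =ᶠ[nhds y] fun _ => 1 := by
        filter_upwards [hV.mem_nhds hy] with z hz using hχV z hz
      rw [this.fderiv_eq]
      simp
    rw [slope, hread, h0, hχV y hy]
    have : ((w (ℓ y + s)) • (0 : SpaceTime n →L[ℝ] ℝ)).smulRight e = 0 := by
      ext; simp
    rw [this, map_zero, add_zero, one_mul, Prod.smul_fst]

/-! ### Relaxed values and their convexity -/

/-- The value `v` is attained at `x`, up to arbitrarily small errors, by test functions in any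
bounded open set whose spatial divergence is arbitrarily small. -/
def Relaxes (F : Rn n × Rn n → ℝ) (x : Rn n × Rn n) (v : ℝ) : Prop :=
  ∀ O : Set (SpaceTime n), IsOpen O → Bornology.IsBounded O → ∀ δ : ℝ, 0 < δ →
    ∃ ζ ∈ testFunctions O, (∀ y, |spatialDiv ζ y| ≤ δ) ∧
      ∫ y in O, F (x + slope ζ y) ≤ (v + δ) * volume.real O

lemma slope_zero (y : SpaceTime n) : slope (0 : SpaceTime n → Target n) y = 0 := by
  simp [slope]

lemma spatialDiv_zero (y : SpaceTime n) : spatialDiv (0 : SpaceTime n → Target n) y = 0 := by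
  simp [spatialDiv]

lemma integrableOn_of_isBounded {F : SpaceTime n → ℝ} (hF : Continuous F)
    {O : Set (SpaceTime n)} (hb : Bornology.IsBounded O) : IntegrableOn F O :=
  (hF.continuousOn.integrableOn_compact hb.isCompact_closure).mono_set subset_closure

lemma relaxes_self (F : Rn n × Rn n → ℝ) (x : Rn n × Rn n) : Relaxes F x (F x) := by
  intro O _ _ δ hδ
  refine ⟨0, zero_mem_testFunctions O, fun y => by simp [spatialDiv_zero, hδ.le], ?_⟩
  simp only [slope_zero, add_zero, setIntegral_const, smul_eq_mul]
  nlinarith [measureReal_nonneg (μ := volume) (s := O)]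

/-- Testing on one ball of positive measure suffices. This bounds the infimum in `relaxation` below
and later allows terms `-η * vᵢ` to be dropped. -/
lemma Relaxes.nonneg {F : Rn n × Rn n → ℝ} (hF : ∀ x, 0 ≤ F x) {x : Rn n × Rn n} {v : ℝ}
    (h : Relaxes F x v) : 0 ≤ v := by
  refine le_of_forall_pos_le_add fun δ hδ => ?_
  obtain ⟨ζ, -, -, hζ⟩ := h (Metric.ball 0 1) Metric.isOpen_ball Metric.isBounded_ball δ hδ
  have h1 : 0 ≤ (v + δ) * volume.real (Metric.ball (0 : SpaceTime n) 1) :=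
    (integral_nonneg fun y => hF _).trans hζ
  have h2 : 0 < volume.real (Metric.ball (0 : SpaceTime n) 1) :=
    ENNReal.toReal_pos (Metric.measure_ball_pos _ _ one_pos).ne' measure_ball_lt_top.ne
  exact nonneg_of_mul_nonneg_left h1 h2

lemma integral_indicator_Ioo_const {a b : ℝ} (ha : 0 ≤ a) (hab : a ≤ b) (hb : b ≤ 1) (v : ℝ) :
    ∫ t in (0 : ℝ)..1, (Set.Ioo a b).indicator (fun _ => v) t = v * (b - a) := by
  rw [intervalIntegral.integral_of_le zero_le_one, setIntegral_indicator measurableSet_Ioo,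
    Set.inter_eq_right.2 (show Set.Ioo a b ⊆ Set.Ioc 0 1 from
      fun t ht => ⟨ha.trans_lt ht.1, ht.2.le.trans hb⟩), setIntegral_const,
    smul_eq_mul, mul_comm, Real.volume_real_Ioo_of_le hab]

/-- The set of values attained by relaxation is stable under convex combinations. -/
lemma Relaxes.convexComb {F : Rn n × Rn n → ℝ} (hF : Continuous F) (hF0 : ∀ x, 0 ≤ F x)
    {x₁ x₂ : Rn n × Rn n} {v₁ v₂ : ℝ} (h₁ : Relaxes F x₁ v₁) (h₂ : Relaxes F x₂ v₂)
    {k l : ℝ} (hk : 0 < k) (hl : 0 < l) (hkl : k + l = 1) :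
    Relaxes F (k • x₁ + l • x₂) (k * v₁ + l * v₂) := by
  intro O hO hOb δ hδ
  have hv₁ := h₁.nonneg hF0
  have hv₂ := h₂.nonneg hF0
  set x := k • x₁ + l • x₂ with hx
  set d := x₂ - x₁ with hd
  -- The two plateau values `0` and `1`, recentred by `l`, move the mean state `x` exactly to `x₁`
  -- and `x₂`.
  have hx₁ : x + (-l) • d = x₁ := by
    rw [hx, hd, show k = 1 - l by linarith]; module
  have hx₂ : x + (1 - l) • d = x₂ := by
    rw [hx, hd, show k = 1 - l by linarith]; module
  rcases O.eq_empty_or_nonempty with rfl | hne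
  · exact ⟨0, zero_mem_testFunctions _, fun y => by simp [spatialDiv_zero, hδ.le], by simp⟩
  have hOfin : volume O ≠ ⊤ := hOb.measure_lt_top.ne
  have hOpos : 0 < volume.real O :=
    ENNReal.toReal_pos (hO.measure_pos volume hne).ne' hOfin
  -- Both budgets use `3 * δ'`: one per test function in the divergence; in the energy, one each for
  -- the relaxed pieces, the transition layers and `O \ V`. The bound `δ' ≤ 1` keeps the laminate
  -- slopes in the ball where `C` bounds `F`.
  obtain ⟨δ', hδ', hδ'1, hδ'δ⟩ : ∃ δ' : ℝ, 0 < δ' ∧ δ' ≤ 1 ∧ 4 * δ' ≤ δ :=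
    ⟨min 1 (δ / 4), by positivity, min_le_left _ _, by linarith [min_le_right 1 (δ / 4)]⟩
  obtain ⟨C, hC0, hC⟩ : ∃ C : ℝ, 0 < C ∧ ∀ z, ‖z‖ ≤ ‖d‖ + 1 → F (x + z) ≤ C := by
    have hc : Continuous fun z => F (x + z) := hF.comp (continuous_const.add continuous_id)
    obtain ⟨C, hC⟩ := (isCompact_closedBall (0 : Rn n × Rn n) (‖d‖ + 1)).exists_bound_of_continuousOn
      hc.continuousOn
    refine ⟨|C| + 1, by positivity, fun z hz => ?_⟩
    have := hC z (by simpa using hz)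
    rw [Real.norm_eq_abs] at this
    linarith [le_abs_self (F (x + z)), le_abs_self C]
  -- The two transitions occupy a fraction `2 * η` of each period, at cost at most `C`.
  obtain ⟨η, hη, hηl, hηk, hηC⟩ : ∃ η : ℝ, 0 < η ∧ η < l ∧ η < k ∧ 2 * η * C ≤ δ' := by
    refine ⟨min (min (l / 2) (k / 2)) (δ' / (2 * C)), by positivity, ?_, ?_, ?_⟩
    · exact (min_le_left _ _).trans_lt ((min_le_left _ _).trans_lt (by linarith))
    · exact (min_le_left _ _).trans_lt ((min_le_right _ _).trans_lt (by linarith))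
    · have := min_le_right (min (l / 2) (k / 2)) (δ' / (2 * C))
      rw [le_div_iff₀ (by positivity)] at this
      linarith
  obtain ⟨K, hKO, hK, hKm⟩ := hO.measurableSet.exists_isCompact_sdiff_lt (μ := volume) hOfin
    (ε := ENNReal.ofReal (δ' * volume.real O / C)) (by positivity)
  obtain ⟨V, hV, hKV, hVO, θ, hθ, hlam⟩ :=
    exists_laminate d.1 d.2 hη hl.le (by linarith) hK hO hKO hδ'
  have hVb := hOb.subset hVO
  have hVle : volume.real V ≤ volume.real O := measureReal_mono hVO hOfin
  have hOV : C * (volume.real O - volume.real V) ≤ δ' * volume.real O := by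
    rw [← measureReal_sdiff hVO hV.measurableSet hOfin]
    have h1 : volume.real (O \ V) ≤ δ' * volume.real O / C := by
      refine ENNReal.toReal_le_of_le_ofReal (by positivity) ?_
      exact (measure_mono (Set.sdiff_subset_sdiff_right hKV)).trans hKm.le
    rw [le_div_iff₀ hC0] at h1
    linarith
  -- choose the phase
  set c : ℝ → ℝ := fun t => C + ((Set.Ioo (l + η) 1).indicator (fun _ => v₁ + δ' - C) t +
    (Set.Ioo η l).indicator (fun _ => v₂ + δ' - C) t) with hc
  have hcm : Measurable c := measurable_const.add
    ((measurable_const.indicator measurableSet_Ioo).add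
      (measurable_const.indicator measurableSet_Ioo))
  have hcb : ∀ t, |c t| ≤ |C| + (|v₁ + δ' - C| + |v₂ + δ' - C|) := by
    intro t
    refine (abs_add_le _ _).trans (add_le_add le_rfl ((abs_add_le _ _).trans (add_le_add ?_ ?_)))
    · exact norm_indicator_le_norm_self (fun _ => v₁ + δ' - C) t
    · exact norm_indicator_le_norm_self (fun _ => v₂ + δ' - C) t
  have hcint : ∫ t in (0 : ℝ)..1, c t =
      C + ((v₁ + δ' - C) * (k - η) + (v₂ + δ' - C) * (l - η)) := by
    have hii : ∀ (S : Set ℝ) (v : ℝ), MeasurableSet S →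
        IntervalIntegrable (S.indicator fun _ => v) volume 0 1 := fun S v hS =>
      intervalIntegrable_iff.2 ((intervalIntegrable_iff.1
        (by simp : IntervalIntegrable (fun _ => v) volume 0 1)).indicator hS)
    simp only [hc]
    rw [intervalIntegral.integral_add (by simp)
      ((hii _ _ measurableSet_Ioo).add (hii _ _ measurableSet_Ioo)),
      intervalIntegral.integral_add (hii _ _ measurableSet_Ioo) (hii _ _ measurableSet_Ioo),
      integral_indicator_Ioo_const (by linarith) (by linarith) le_rfl,
      integral_indicator_Ioo_const hη.le hηl.le (by linarith),
      show (1 : ℝ) - (l + η) = k - η by linarith]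
    simp
  have : IsFiniteMeasure (volume.restrict V) := ⟨by simpa using hVb.measure_lt_top⟩
  -- `c` is the price of a phase: `vᵢ + δ'` where the laminate sits at `xᵢ`, and `C` in the
  -- transitions. The shift can be chosen last because `V` and `θ` do not depend on it.
  obtain ⟨s, hs⟩ := exists_phase_shift (volume.restrict V) hθ.measurable hcm hcb
  obtain ⟨ζ₀, hζ₀, hdiv₀, hbd₀, hex₀⟩ := hlam s
  set O₁ := V ∩ {y | Int.fract (θ y + s) ∈ Set.Ioo (l + η) 1} with hO₁
  set O₂ := V ∩ {y | Int.fract (θ y + s) ∈ Set.Ioo η l} with hO₂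
  have hθs : Continuous fun y => θ y + s := hθ.add continuous_const
  have hO₁o : IsOpen O₁ :=
    hV.inter ((isOpen_fract_mem_Ioo (by linarith) le_rfl).preimage hθs)
  have hO₂o : IsOpen O₂ :=
    hV.inter ((isOpen_fract_mem_Ioo hη.le (by linarith)).preimage hθs)
  have hdisj : Disjoint O₁ O₂ := by
    rw [Set.disjoint_left]
    rintro y ⟨-, h1⟩ ⟨-, h2⟩
    exact absurd h1.1 (not_lt.2 (by linarith [h2.2]))
  have hO₁O : O₁ ⊆ O := Set.inter_subset_left.trans hVO
  have hO₂O : O₂ ⊆ O := Set.inter_subset_left.trans hVO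
  have hO₁b := hOb.subset hO₁O
  have hO₂b := hOb.subset hO₂O
  have hs' : C * volume.real V + ((v₁ + δ' - C) * volume.real O₁ + (v₂ + δ' - C) * volume.real O₂) ≤
      volume.real V * (C + ((v₁ + δ' - C) * (k - η) + (v₂ + δ' - C) * (l - η))) := by
    rw [measureReal_restrict_apply_univ, hcint] at hs
    refine le_trans (le_of_eq ?_) hs
    have hms : ∀ S : Set ℝ, MeasurableSet S → MeasurableSet {y | Int.fract (θ y + s) ∈ S} :=
      fun S hS => (measurable_fract.comp hθs.measurable) hS
    have hceq : ∀ y, c (Int.fract (θ y + s)) =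
        C + ({y | Int.fract (θ y + s) ∈ Set.Ioo (l + η) 1}.indicator (fun _ => v₁ + δ' - C) y +
          {y | Int.fract (θ y + s) ∈ Set.Ioo η l}.indicator (fun _ => v₂ + δ' - C) y) :=
      fun y => rfl
    have hint : ∀ (S : Set ℝ) (v : ℝ), MeasurableSet S → Integrable
        ({y | Int.fract (θ y + s) ∈ S}.indicator fun _ => v) (volume.restrict V) :=
      fun S v hS => (integrable_const v).indicator (hms S hS)
    simp only [hceq]
    rw [integral_add (integrable_const C) (show Integrable (fun y =>
        {y | Int.fract (θ y + s) ∈ Set.Ioo (l + η) 1}.indicator (fun _ => v₁ + δ' - C) y +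
          {y | Int.fract (θ y + s) ∈ Set.Ioo η l}.indicator (fun _ => v₂ + δ' - C) y)
        (volume.restrict V) from
          (hint _ _ measurableSet_Ioo).add (hint _ _ measurableSet_Ioo)),
      integral_add (hint _ _ measurableSet_Ioo) (hint _ _ measurableSet_Ioo),
      setIntegral_indicator (hms _ measurableSet_Ioo),
      setIntegral_indicator (hms _ measurableSet_Ioo)]
    simp only [setIntegral_const, smul_eq_mul]
    ring
  obtain ⟨ζ₁, hζ₁, hdiv₁, hint₁⟩ := h₁ O₁ hO₁o hO₁b δ' hδ'
  obtain ⟨ζ₂, hζ₂, hdiv₂, hint₂⟩ := h₂ O₂ hO₂o hO₂b δ' hδ'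
  have hζ₁O := testFunctions_mono hO₁O hζ₁
  have hζ₂O := testFunctions_mono hO₂O hζ₂
  have hζ := add_mem_testFunctions (add_mem_testFunctions hζ₀ hζ₁O) hζ₂O
  have hslope : ∀ y, slope (ζ₀ + ζ₁ + ζ₂) y = slope ζ₀ y + slope ζ₁ y + slope ζ₂ y := fun y => by
    rw [slope_add (add_mem_testFunctions hζ₀ hζ₁O) hζ₂O, slope_add hζ₀ hζ₁O]
  refine ⟨ζ₀ + ζ₁ + ζ₂, hζ, fun y => ?_, ?_⟩
  · rw [spatialDiv_add (add_mem_testFunctions hζ₀ hζ₁O) hζ₂O, spatialDiv_add hζ₀ hζ₁O]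
    have := abs_add_three (spatialDiv ζ₀ y) (spatialDiv ζ₁ y) (spatialDiv ζ₂ y)
    linarith [hdiv₀ y, hdiv₁ y, hdiv₂ y]
  have hcont : Continuous fun y => F (x + slope (ζ₀ + ζ₁ + ζ₂) y) :=
    hF.comp (continuous_const.add (continuous_slope hζ))
  -- On `O₁` the laminate shifts `x` to `x₁` and `ζ₂` contributes nothing, so the integrand is the
  -- one controlled by the choice of `ζ₁`.
  have hI₁ : ∫ y in O₁, F (x + slope (ζ₀ + ζ₁ + ζ₂) y) ≤ (v₁ + δ') * volume.real O₁ := by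
    refine le_trans (le_of_eq ?_) hint₁
    refine setIntegral_congr_fun hO₁o.measurableSet fun y hy => ?_
    have h0 : slope ζ₂ y = 0 :=
      slope_eq_zero_of_notMem fun h => Set.disjoint_left.1 hdisj hy (hζ₂.2.2 h)
    rw [hslope, h0, add_zero, hex₀ y hy.1, plateau_of_add_le hη hl.le hy.2.1.le, ← add_assoc,
      zero_sub, hx₁]
  have hI₂ : ∫ y in O₂, F (x + slope (ζ₀ + ζ₁ + ζ₂) y) ≤ (v₂ + δ') * volume.real O₂ := by
    refine le_trans (le_of_eq ?_) hint₂
    refine setIntegral_congr_fun hO₂o.measurableSet fun y hy => ?_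
    have h0 : slope ζ₁ y = 0 :=
      slope_eq_zero_of_notMem fun h => Set.disjoint_left.1 hdisj (hζ₁.2.2 h) hy
    rw [hslope, h0, add_zero, hex₀ y hy.1, plateau_eq_one hη hy.2.1.le hy.2.2.le, ← add_assoc, hx₂]
  have hU : O₁ ∪ O₂ ⊆ O := Set.union_subset hO₁O hO₂O
  have hUm : MeasurableSet (O₁ ∪ O₂) := (hO₁o.union hO₂o).measurableSet
  have hUr : volume.real (O₁ ∪ O₂) = volume.real O₁ + volume.real O₂ :=
    measureReal_union hdisj hO₂o.measurableSet hO₁b.measure_lt_top.ne hO₂b.measure_lt_top.ne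
  -- Only the laminate is active here, so the crude bound `C` applies both in the transitions and in
  -- the cutoff zone.
  have hI₃ : ∫ y in O \ (O₁ ∪ O₂), F (x + slope (ζ₀ + ζ₁ + ζ₂) y) ≤
      C * (volume.real O - (volume.real O₁ + volume.real O₂)) := by
    rw [← hUr, ← measureReal_sdiff hU hUm hOfin, mul_comm C,
      ← smul_eq_mul, ← setIntegral_const]
    refine setIntegral_mono_on (integrableOn_of_isBounded hcont (hOb.subset Set.sdiff_subset))
      (integrableOn_of_isBounded continuous_const (hOb.subset Set.sdiff_subset))
      (hO.measurableSet.diff hUm) fun y hy => hC _ ?_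
    have h1 : slope ζ₁ y = 0 := slope_eq_zero_of_notMem fun h => hy.2 (Or.inl (hζ₁.2.2 h))
    have h2 : slope ζ₂ y = 0 := slope_eq_zero_of_notMem fun h => hy.2 (Or.inr (hζ₂.2.2 h))
    rw [hslope, h1, h2, add_zero, add_zero]
    exact (hbd₀ y).trans (add_le_add le_rfl hδ'1)
  have hsplit : ∫ y in O, F (x + slope (ζ₀ + ζ₁ + ζ₂) y) =
      (∫ y in O₁, F (x + slope (ζ₀ + ζ₁ + ζ₂) y)) + (∫ y in O₂, F (x + slope (ζ₀ + ζ₁ + ζ₂) y)) +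
        ∫ y in O \ (O₁ ∪ O₂), F (x + slope (ζ₀ + ζ₁ + ζ₂) y) := by
    rw [← setIntegral_union hdisj hO₂o.measurableSet (integrableOn_of_isBounded hcont hO₁b)
      (integrableOn_of_isBounded hcont hO₂b),
      setIntegral_sdiff hUm (integrableOn_of_isBounded hcont hOb) hU]
    ring
  rw [hsplit]
  have hfinal : C + ((v₁ + δ' - C) * (k - η) + (v₂ + δ' - C) * (l - η)) ≤
      k * v₁ + l * v₂ + 2 * δ' := by
    have hk' : k = 1 - l := by linarith
    subst hk'
    nlinarith [mul_nonneg hη.le hv₁, mul_nonneg hη.le hv₂, mul_pos hη hδ']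
  have h3 : volume.real V * (C + ((v₁ + δ' - C) * (k - η) + (v₂ + δ' - C) * (l - η))) ≤
      volume.real O * (k * v₁ + l * v₂ + 2 * δ') :=
    (mul_le_mul_of_nonneg_left hfinal measureReal_nonneg).trans
      (mul_le_mul_of_nonneg_right hVle (by positivity))
  nlinarith [mul_le_mul_of_nonneg_right hδ'δ hOpos.le]

/-- The infimum of the values attained by relaxation. -/
def relaxation (F : Rn n × Rn n → ℝ) (x : Rn n × Rn n) : ℝ :=
  sInf {v | Relaxes F x v}

lemma bddBelow_relaxes {F : Rn n × Rn n → ℝ} (hF0 : ∀ x, 0 ≤ F x) (x : Rn n × Rn n) :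
    BddBelow {v | Relaxes F x v} :=
  ⟨0, fun _ hv => Relaxes.nonneg hF0 hv⟩

lemma relaxation_le {F : Rn n × Rn n → ℝ} (hF0 : ∀ x, 0 ≤ F x) (x : Rn n × Rn n) :
    relaxation F x ≤ F x :=
  csInf_le (bddBelow_relaxes hF0 x) (relaxes_self F x)

lemma le_relaxation {F : Rn n × Rn n → ℝ} {x : Rn n × Rn n} {r : ℝ}
    (h : ∀ v, Relaxes F x v → r ≤ v) : r ≤ relaxation F x :=
  le_csInf (s := {v | Relaxes F x v}) ⟨F x, relaxes_self F x⟩ h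

lemma convexOn_relaxation {F : Rn n × Rn n → ℝ} (hF : Continuous F) (hF0 : ∀ x, 0 ≤ F x) :
    ConvexOn ℝ Set.univ (relaxation F) := by
  refine convexOn_iff_forall_pos.2 ⟨convex_univ, fun x _ y _ k l hk hl hkl => ?_⟩
  refine le_of_forall_pos_le_add fun ε hε => ?_
  obtain ⟨v₁, hv₁, h1⟩ := exists_lt_of_csInf_lt ⟨F x, relaxes_self F x⟩
    (lt_add_of_pos_right (relaxation F x) hε)
  obtain ⟨v₂, hv₂, h2⟩ := exists_lt_of_csInf_lt ⟨F y, relaxes_self F y⟩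
    (lt_add_of_pos_right (relaxation F y) hε)
  calc relaxation F (k • x + l • y) ≤ k * v₁ + l * v₂ :=
        csInf_le (bddBelow_relaxes hF0 _) (Relaxes.convexComb hF hF0 hv₁ hv₂ hk hl hkl)
    _ ≤ k * (relaxation F x + ε) + l * (relaxation F y + ε) := by gcongr
    _ = k • relaxation F x + l • relaxation F y + ε := by
        simp only [smul_eq_mul]; linear_combination ε * hkl

/-- The relaxation is itself one of the convex minorants in the supremum. -/
lemma relaxation_le_convexHullFun {F : Rn n × Rn n → ℝ} (hF : Continuous F) (hF0 : ∀ x, 0 ≤ F x)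
    (x : Rn n × Rn n) : relaxation F x ≤ convexHullFun F x := by
  refine le_csSup ⟨F x, ?_⟩ ⟨relaxation F, convexOn_relaxation hF hF0, relaxation_le hF0, rfl⟩
  rintro v ⟨h, -, hle, rfl⟩
  exact hle x

/-! ### Mean-zero gradients and the Jensen bound -/

lemma integral_fderiv_eq_zero_of_hasCompactSupport {E G : Type*} [NormedAddCommGroup E]
    [NormedSpace ℝ E] [FiniteDimensional ℝ E] [MeasurableSpace E] [BorelSpace E]
    [NormedAddCommGroup G] [NormedSpace ℝ G] [CompleteSpace G] (μ : Measure E)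
    [μ.IsAddHaarMeasure] {f : E → G} (hf : ContDiff ℝ 1 f) (hc : HasCompactSupport f) :
    ∫ y, fderiv ℝ f y ∂μ = 0 := by
  have hi : Integrable (fderiv ℝ f) μ :=
    (hf.continuous_fderiv (by simp)).integrable_of_hasCompactSupport (hc.fderiv (𝕜 := ℝ))
  ext v
  rw [ContinuousLinearMap.integral_apply hi]
  -- Integration by parts against the constant `1`.
  have h := integral_smul_fderiv_eq_neg_fderiv_smul_of_integrable (𝕜 := ℝ) (μ := μ)
    (f := fun _ => (1 : ℝ)) (g := f) (v := v) (by simp)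
    (by simpa using hi.apply_continuousLinearMap v)
    (by simpa using hf.continuous.integrable_of_hasCompactSupport hc)
    (fun x _ => differentiableAt_const _) (fun x _ => hf.differentiable (by simp) x)
  simpa using h

lemma setIntegral_readout_eq_zero {Q : Set (SpaceTime n)} {ζ : SpaceTime n → Target n}
    (h : ζ ∈ testFunctions Q) : ∫ y in Q, readout n (fderiv ℝ ζ y) = 0 := by
  have hi : Integrable (fderiv ℝ ζ) :=
    (h.1.continuous_fderiv (by simp)).integrable_of_hasCompactSupport (h.2.1.fderiv (𝕜 := ℝ))
  rw [setIntegral_eq_integral_of_forall_compl_eq_zero fun y hy => by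
      rw [fderiv_of_notMem_tsupport ℝ fun hy' => hy (h.2.2 hy'), map_zero],
    (readout n).integral_comp_comm hi,
    integral_fderiv_eq_zero_of_hasCompactSupport volume (h.1.of_le (by exact_mod_cast le_top))
      h.2.1, map_zero]

/-- Jensen's inequality for the slope and the divergence of a test function. -/
lemma convex_le_average {Q : Set (SpaceTime n)} (hQ : IsOpen Q) (hQb : Bornology.IsBounded Q)
    (hQne : Q.Nonempty) {F h : Rn n × Rn n → ℝ} (hF : Continuous F)
    (hh : ConvexOn ℝ Set.univ h) (hhF : ∀ x, h x ≤ F x) (x : Rn n × Rn n) (s τ : ℝ)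
    {ζ : SpaceTime n → Target n} (hζ : ζ ∈ testFunctions Q) :
    h x + (s - τ) ^ 2 ≤
      (volume.real Q)⁻¹ * ∫ y in Q, (F (x + slope ζ y) + (s - (τ + spatialDiv ζ y)) ^ 2) := by
  have hhc : Continuous h := by
    simpa [continuousOn_univ] using hh.continuousOn isOpen_univ
  have hH : ConvexOn ℝ Set.univ fun z : (Rn n × Rn n) × ℝ => h z.1 + (s - z.2) ^ 2 := by
    refine ⟨convex_univ, fun z _ z' _ k l hk hl hkl => ?_⟩
    have h1 := hh.2 (Set.mem_univ z.1) (Set.mem_univ z'.1) hk hl hkl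
    have h2 : (s - (k * z.2 + l * z'.2)) ^ 2 ≤ k * (s - z.2) ^ 2 + l * (s - z'.2) ^ 2 := by
      obtain rfl : k = 1 - l := by linarith
      nlinarith [mul_nonneg (mul_nonneg hk hl) (sq_nonneg (z.2 - z'.2))]
    simp only [smul_eq_mul, Prod.fst_add, Prod.snd_add, Prod.smul_fst, Prod.smul_snd] at h1 ⊢
    linarith
  have hHc : Continuous fun z : (Rn n × Rn n) × ℝ => h z.1 + (s - z.2) ^ 2 := by fun_prop
  have hrc := continuous_readout_fderiv hζ
  have hfc : Continuous fun y => ((x, τ) : (Rn n × Rn n) × ℝ) + readout n (fderiv ℝ ζ y) :=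
    continuous_const.add hrc
  have hri : IntegrableOn (fun y => readout n (fderiv ℝ ζ y)) Q :=
    (hrc.continuousOn.integrableOn_compact hQb.isCompact_closure).mono_set subset_closure
  have hQ0 : volume Q ≠ 0 := (hQ.measure_pos volume hQne).ne'
  have hQt : volume Q ≠ ⊤ := hQb.measure_lt_top.ne
  have hQr : volume.real Q ≠ 0 := (ENNReal.toReal_pos hQ0 hQt).ne'
  have : IsFiniteMeasure (volume.restrict Q) := ⟨by simpa using hQb.measure_lt_top⟩
  have hJ := hH.map_set_average_le hHc.continuousOn isClosed_univ hQ0 hQt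
    (Filter.Eventually.of_forall fun y => Set.mem_univ _)
    (f := fun y => ((x, τ) : (Rn n × Rn n) × ℝ) + readout n (fderiv ℝ ζ y))
    ((integrable_const _).add hri)
    (integrableOn_of_isBounded (hHc.comp hfc) hQb)
  have havg : ⨍ y in Q, (((x, τ) : (Rn n × Rn n) × ℝ) + readout n (fderiv ℝ ζ y)) = (x, τ) := by
    rw [setAverage_eq, integral_add (integrable_const _) hri, setIntegral_readout_eq_zero hζ,
      add_zero, setIntegral_const, smul_smul, inv_mul_cancel₀ hQr, one_smul]
  rw [havg, setAverage_eq, smul_eq_mul] at hJ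
  refine hJ.trans (mul_le_mul_of_nonneg_left ?_ (inv_nonneg.2 measureReal_nonneg))
  refine setIntegral_mono_on (integrableOn_of_isBounded (hHc.comp hfc) hQb)
    (integrableOn_of_isBounded ?_ hQb) hQ.measurableSet fun y _ => ?_
  · have h1 := continuous_slope hζ
    have h2 := continuous_spatialDiv hζ
    fun_prop
  · exact add_le_add (hhF _) le_rfl

/-! ### Cubes and the two bounds for the averaged energy -/

lemma isOpen_cube {Q : Set (SpaceTime n)} (hQ : IsOpenCube Q) : IsOpen Q := by
  obtain ⟨b, a, L, -, rfl⟩ := hQ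
  simp only [Set.ofPred_forall]
  refine isOpen_iInter_of_finite fun i => ?_
  exact isOpen_Ioo.preimage
    (continuous_const.inner (continuous_id.sub continuous_const) :
      Continuous fun y => inner ℝ (b i) (y - a))

lemma isBounded_cube {Q : Set (SpaceTime n)} (hQ : IsOpenCube Q) : Bornology.IsBounded Q := by
  obtain ⟨b, a, L, -, rfl⟩ := hQ
  refine (Metric.isBounded_closedBall (x := a) (r := ∑ _i : Fin n ⊕ Unit, L)).subset fun y hy => ?_
  rw [mem_closedBall_iff_norm, ← b.sum_repr' (y - a)]
  refine (norm_sum_le _ _).trans (Finset.sum_le_sum fun i _ => ?_)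
  rw [norm_smul, b.norm_eq_one, mul_one, Real.norm_eq_abs, abs_of_pos (hy i).1]
  exact (hy i).2.le

lemma nonempty_cube {Q : Set (SpaceTime n)} (hQ : IsOpenCube Q) : Q.Nonempty := by
  obtain ⟨b, a, L, hL, rfl⟩ := hQ
  refine ⟨a + ∑ i, (L / 2) • b i, fun i => ?_⟩
  rw [add_sub_cancel_left, b.orthonormal.inner_right_fintype]
  constructor <;> linarith

/-- A relaxed value bounds the averaged energy from above: the divergence term can be kept
almost constant. -/
lemma exists_average_le {Q : Set (SpaceTime n)} (hQ : IsOpen Q) (hQb : Bornology.IsBounded Q)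
    (hQne : Q.Nonempty) {F : Rn n × Rn n → ℝ} (hF : Continuous F) {x : Rn n × Rn n} {v : ℝ}
    (hv : Relaxes F x v) (s τ : ℝ) {ε : ℝ} (hε : 0 < ε) :
    ∃ ζ ∈ testFunctions Q,
      (volume.real Q)⁻¹ * ∫ y in Q, (F (x + slope ζ y) + (s - (τ + spatialDiv ζ y)) ^ 2) ≤
        v + (s - τ) ^ 2 + ε := by
  -- Expanding the square costs `δ² + 2 * |s - τ| * δ ≤ δ * (1 + 2 * |s - τ|)`; the remaining `δ` is
  -- the error in `Relaxes`.
  obtain ⟨δ, hδ, hδ1, hδε⟩ : ∃ δ : ℝ, 0 < δ ∧ δ ≤ 1 ∧ δ * (2 + 2 * |s - τ|) ≤ ε :=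
    ⟨min 1 (ε / (2 + 2 * |s - τ|)), by positivity, min_le_left _ _,
      (le_div_iff₀ (by positivity)).1 (min_le_right _ _)⟩
  obtain ⟨ζ, hζ, hdiv, hint⟩ := hv Q hQ hQb δ hδ
  have hQr : 0 < volume.real Q :=
    ENNReal.toReal_pos (hQ.measure_pos volume hQne).ne' hQb.measure_lt_top.ne
  have h1 := continuous_slope hζ
  have h2 := continuous_spatialDiv hζ
  have hle : ∫ y in Q, (s - (τ + spatialDiv ζ y)) ^ 2 ≤
      ∫ _ in Q, ((s - τ) ^ 2 + δ * (1 + 2 * |s - τ|)) := by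
    refine setIntegral_mono_on (integrableOn_of_isBounded (by fun_prop) hQb)
      (integrableOn_of_isBounded continuous_const hQb) hQ.measurableSet fun y _ => ?_
    have h3 : |(s - τ) * spatialDiv ζ y| ≤ |s - τ| * δ := by
      rw [abs_mul]; gcongr; exact hdiv y
    have h4 : spatialDiv ζ y ^ 2 ≤ δ ^ 2 := sq_le_sq' (abs_le.1 (hdiv y)).1 (abs_le.1 (hdiv y)).2
    nlinarith [(abs_le.1 h3).1]
  refine ⟨ζ, hζ, ?_⟩
  rw [integral_add (integrableOn_of_isBounded (by fun_prop) hQb)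
    (integrableOn_of_isBounded (by fun_prop) hQb), inv_mul_le_iff₀ hQr]
  rw [setIntegral_const, smul_eq_mul] at hle
  nlinarith

end DiffusionRelaxation

end

theorem proposition2p2 (n : ℕ)
    (σ : DiffusionRelaxation.Rn n → DiffusionRelaxation.Rn n) (hσ : Continuous σ)
    (c₁ : ℝ) (hc₁ : 0 < c₁) (hgrowth : ∀ p, ‖σ p‖ ≤ c₁ * (‖p‖ + 1))
    (Q : Set (DiffusionRelaxation.SpaceTime n)) (hQ : DiffusionRelaxation.IsOpenCube Q)
    (ω : DiffusionRelaxation.Target n) (ξ : DiffusionRelaxation.GradMatrix n) :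
    DiffusionRelaxation.sharp Q (DiffusionRelaxation.density σ) ω ξ =
      DiffusionRelaxation.gHull σ (DiffusionRelaxation.pBlock ξ)
          (DiffusionRelaxation.betaBlock ξ)
        + (ω (Sum.inl ()) - (DiffusionRelaxation.BBlock ξ).trace) ^ 2 := by
  open DiffusionRelaxation in
  have hF : Continuous fun x : Rn n × Rn n => ‖σ x.1 - x.2‖ ^ 2 := by fun_prop
  have hF0 : ∀ x : Rn n × Rn n, 0 ≤ ‖σ x.1 - x.2‖ ^ 2 := fun x => sq_nonneg _
  have hQo := isOpen_cube hQ
  have hQb := isBounded_cube hQ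
  have hQn := nonempty_cube hQ
  simp only [sharp, gHull, density_add_gradMatrix]
  apply le_antisymm
  -- Upper bound: every relaxed value at `(p, β)` is almost realised on `Q`.
  · rw [← sub_le_iff_le_add]
    refine le_trans ?_ (relaxation_le_convexHullFun hF hF0 _)
    refine le_relaxation fun v hv => ?_
    rw [sub_le_iff_le_add]
    refine le_of_forall_pos_le_add fun ε hε => ?_
    obtain ⟨ζ, hζ, hle⟩ := exists_average_le hQo hQb hQn hF hv (ω (Sum.inl ()))
      (BBlock ξ).trace hε
    refine le_trans (csInf_le ⟨0, ?_⟩ ⟨ζ, hζ, rfl⟩) hle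
    rintro _ ⟨ζ', -, rfl⟩
    exact mul_nonneg (inv_nonneg.2 MeasureTheory.measureReal_nonneg)
      (MeasureTheory.integral_nonneg fun y => add_nonneg (sq_nonneg _) (sq_nonneg _))
  -- Lower bound: Jensen for each convex minorant and each test function.
  · refine le_csInf ⟨_, 0, zero_mem_testFunctions Q, rfl⟩ ?_
    rintro _ ⟨ζ, hζ, rfl⟩
    rw [← le_sub_iff_add_le]
    refine csSup_le ⟨0, fun _ => 0, convexOn_const 0 convex_univ, hF0, rfl⟩ ?_
    rintro _ ⟨h, hh, hhF, rfl⟩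
    rw [le_sub_iff_add_le]
    exact convex_le_average hQo hQb hQn hF hh hhF _ _ _ hζ
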